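/- All rings are associative with unity $1$. A ring $R$ is \emph{semicommutative} if for all $a,b\in R$, $ab=0$ implies $aRb=0$; \emph{reflexive} if for all $a,b\in R$, $aRb=0$ implies $bRa=0$; and \emph{duo} if every right ideal and every left ideal of $R$ is two-sided (equivalently, $ba\in aR$ and $ab\in Ra$ for all $a,b\in R$). A ring is called a \emph{minimal} nonreflexive semicommutative nonduo ring if it is semicommutative, not reflexive and not duo, and no ring with these three properties has smaller cardinality. \textbf{Theorem (Minimal Nonreflexive Semicommutative Nonduo).} Every minimal nonreflexive semicommutative nonduo ring has order $16$. Up to isomorphism there are exactly two such rings, namely $$\frac{\mathbb{F}_2\langle u,v\rangle}{\langle u^3,\ v^2,\ vu,\ u^2-uv\rangle}\qquad\text{and}\qquad \frac{\mathbb{Z}_4\langle u,v\rangle}{\langle u^3,\ v^2,\ vu,\ u^2-uv,\ 2-uv,\ 2u,\ 2v\rangle},$$ where $\mathbb{F}_2\langle u,v\rangle$ and $\mathbb{Z}_4\langle u,v\rangle$ denote the free associative unital algebras on two noncommuting variables $u,v$ over $\mathbb{F}_2$ and $\mathbb{Z}_4=\mathbb{Z}/4\mathbb{Z}$, and the denominators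 are the two-sided ideals generated by the listed elements. These two rings are not isomorphic to each other, and each is a minimal nonreflexive semicommutative nonduo ring of order $16$. -/

import Mathlib

universe u

/-- `ab = 0` implies `aRb = 0`. -/
def IsSemicommutativeRing (R : Type u) [Ring R] : Prop :=
  ∀ a b : R, a * b = 0 → ∀ r : R, a * r * b = 0

/-- `aRb = 0` implies `bRa = 0`. -/
def IsReflexiveRing (R : Type u) [Ring R] : Prop :=
  ∀ a b : R, (∀ r : R, a * r * b = 0) → ∀ r : R, b * r * a = 0

/-- `Ra ⊆ aR` for every `a`; equivalently, every right ideal is two-sided. -/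
def IsRightDuoRing (R : Type u) [Ring R] : Prop :=
  ∀ a b : R, ∃ c : R, b * a = a * c

/-- `aR ⊆ Ra` for every `a`; equivalently, every left ideal is two-sided. -/
def IsLeftDuoRing (R : Type u) [Ring R] : Prop :=
  ∀ a b : R, ∃ c : R, a * b = c * a

def IsDuoRing (R : Type u) [Ring R] : Prop :=
  IsRightDuoRing R ∧ IsLeftDuoRing R

def IsNonreflexiveSemicommutativeNonduo (R : Type u) [Ring R] : Prop :=
  ¬ IsReflexiveRing R ∧ IsSemicommutativeRing R ∧ ¬ IsDuoRing R

/-- `R` has property `P`, and no ring with property `P` has smaller cardinality. -/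
def IsMinimalRingWith (P : (S : Type u) → [Ring S] → Prop) (R : Type u) [Ring R] : Prop :=
  P R ∧ ∀ (S : Type u) [Ring S], P S → Cardinal.mk R ≤ Cardinal.mk S

/-- The two-sided ideal `(u³, v², vu, u² - uv)` of `𝔽₂⟨u,v⟩`, with `u = ι 0`, `v = ι 1`. -/
def idealF2 : TwoSidedIdeal (FreeAlgebra (ZMod 2) (Fin 2)) :=
  let u := FreeAlgebra.ι (ZMod 2) (0 : Fin 2)
  let v := FreeAlgebra.ι (ZMod 2) (1 : Fin 2)
  TwoSidedIdeal.span {u ^ 3, v ^ 2, v * u, u ^ 2 - u * v}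

/-- `𝔽₂⟨u,v⟩ / (u³, v², vu, u² - uv)`. -/
abbrev RingF2 : Type := idealF2.ringCon.Quotient

/-- The two-sided ideal `(u³, v², vu, u² - uv, 2 - uv, 2u, 2v)` of `ℤ₄⟨u,v⟩`, with `u = ι 0`,
`v = ι 1`. -/
def idealZ4 : TwoSidedIdeal (FreeAlgebra (ZMod 4) (Fin 2)) :=
  let u := FreeAlgebra.ι (ZMod 4) (0 : Fin 2)
  let v := FreeAlgebra.ι (ZMod 4) (1 : Fin 2)
  TwoSidedIdeal.span {u ^ 3, v ^ 2, v * u, u ^ 2 - u * v, 2 - u * v, 2 * u, 2 * v}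

/-- `ℤ₄⟨u,v⟩ / (u³, v², vu, u² - uv, 2 - uv, 2u, 2v)`. -/
abbrev RingZ4 : Type := idealZ4.ringCon.Quotient

/-!
# Minimal nonreflexive semicommutative nonduo rings

In a finite semicommutative ring that is not reflexive there are `a`, `b` with `ab = 0` and `ba ≠ 0`.
Semicommutativity and pigeonhole show that `b aⁿ = 0` and `bⁿ a = 0` for large `n`, so after passing
to suitable powers one may assume that `w = ba` also satisfies `bw = wa = 0`
(`exists_isExtremalPair`). For such a pair the sixteen elements `x = i + ja + kb + lw` with
`i, j, k, l ∈ {0, 1}` are distinct, because `bxa = iw`, `bx - xb = jw` and `xa - ax = kw`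
(`IsExtremalPair.normalForm_injective`). Hence the order is at least `16`.

If the order is exactly `16`, every element has this form. Each of `2`, `a²`, `b²` commutes with `a`
and `b`, and the same three formulas place it in `{0, w}`
(`IsExtremalPair.eq_zero_or_eq_mul`). This determines the ring up to the eight choices. When
`a² = b² = w` the ring is duo (`IsExtremalPair.isDuoRing`); in the other cases a change of
generators produces `u`, `v` with `vu = v² = 0`, `u² = uv ≠ 0`, `u³ = 0`
(`IsExtremalPair.exists_isModel`), and only the alternative `2 = 0` or `2 = uv` remains.

Conversely, each of the two presented rings consists of normal forms in its generators. That `uv`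
does not vanish is seen in a concrete representation (`isModel_matrix`,
`exists_isModel_two_eq_mul`); then `(v, u)` is an extremal pair, so the normal forms are distinct,
the order is `16`, and the homomorphism to any other ring of order `16` satisfying the relations is
bijective (`IsModel.bijective_of_map_eq`).
-/

/-! ### Extremal pairs and the lower bound -/

/-- `(a, b)` is an *extremal pair* if `ab = 0` while `ba` is nonzero and is killed by `b` on the left
and by `a` on the right. (It is killed by `a` on the left and by `b` on the right since `ab = 0`.) -/
structure IsExtremalPair {R : Type u} [Ring R] (a b : R) : Prop where
  mul_eq_zero : a * b = 0
  mul_ne_zero : b * a ≠ 0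
  mul_mul_left : b * (b * a) = 0
  mul_mul_right : b * a * a = 0

/-- In a finite semicommutative ring `ab = 0` makes `b aⁿ` and `bⁿ a` vanish for large `n`, although
`a` and `b` need not be nilpotent. -/
theorem IsSemicommutativeRing.exists_mul_pow_eq_zero {R : Type u} [Ring R] [Finite R]
    (hR : IsSemicommutativeRing R) {a b : R} (hab : a * b = 0) :
    (∃ n : ℕ, b * a ^ n = 0) ∧ ∃ n : ℕ, b ^ n * a = 0 := by
  -- By pigeonhole `xᵐ = xᵐ⁺ᵖ⁺¹`. For `x = a`, semicommutativity turns `(1 - aᵖ⁺¹) aᵐ = 0` into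
  -- `(1 - aᵖ⁺¹) b aᵐ = b aᵐ - aᵖ⁺¹ b aᵐ = 0`, where the subtracted term vanishes as `ab = 0`.
  have key (x : R) : ∃ m p : ℕ, x ^ m * (1 - x ^ (p + 1)) = 0 := by
    obtain ⟨m, n, hmn, h⟩ := Finite.exists_ne_map_eq_of_infinite (fun k : ℕ => x ^ k)
    wlog hlt : m < n generalizing m n
    · exact this n m hmn.symm h.symm (by omega)
    obtain ⟨p, rfl⟩ := Nat.exists_eq_add_of_lt hlt
    refine ⟨m, p, ?_⟩
    rw [mul_sub, mul_one, ← pow_add, ← add_assoc]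
    exact sub_eq_zero.2 h
  constructor
  · obtain ⟨m, p, h⟩ := key a
    refine ⟨m, ?_⟩
    have hc : (1 - a ^ (p + 1)) * a ^ m = 0 := by
      rw [← h, mul_sub, sub_mul, one_mul, mul_one, ← pow_add, ← pow_add, add_comm m]
    have h' := hR _ _ hc b
    rwa [sub_mul, one_mul, pow_succ, mul_assoc, hab, mul_zero, sub_zero] at h'
  · obtain ⟨m, p, h⟩ := key b
    refine ⟨m, ?_⟩
    have h' := hR _ _ h a
    rwa [mul_sub, mul_one, pow_succ', mul_assoc, ← mul_assoc a, hab, zero_mul, mul_zero,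
      sub_zero] at h'

/-- A witness of nonreflexivity gives `ab = 0` and `ba ≠ 0`. Replacing `a` by its highest power with
`b aʲ ≠ 0`, and then `b` by its highest power with `bⁱ aʲ ≠ 0`, makes the pair extremal. -/
theorem exists_isExtremalPair {R : Type u} [Ring R] [Finite R]
    (hR : IsSemicommutativeRing R) (hn : ¬ IsReflexiveRing R) :
    ∃ a b : R, IsExtremalPair a b := by
  classical
  simp only [IsReflexiveRing, not_forall] at hn
  obtain ⟨a₀, b, h0, r, hr⟩ := hn
  obtain ⟨a, ha⟩ : ∃ a, a = r * a₀ := ⟨_, rfl⟩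
  have hab : a * b = 0 := by
    have := h0 1
    rw [mul_one] at this
    rw [ha, mul_assoc, this, mul_zero]
  have hba : b * a ≠ 0 := by rwa [ha, ← mul_assoc]
  have hex := (hR.exists_mul_pow_eq_zero hab).1
  obtain ⟨j, hj⟩ : ∃ j, Nat.find hex = j + 2 := by
    refine Nat.exists_eq_add_of_le' ?_
    by_contra! hlt
    have := Nat.find_spec hex
    interval_cases h : Nat.find hex
    · exact hba (by rw [pow_zero, mul_one] at this; rw [this, zero_mul])
    · exact hba (by rwa [pow_one] at this)
  have hj0 : b * a ^ (j + 2) = 0 := hj ▸ Nat.find_spec hex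
  have hj1 : b * a ^ (j + 1) ≠ 0 := Nat.find_min hex (by omega)
  have hab' : a ^ (j + 1) * b = 0 := by rw [pow_succ, mul_assoc, hab, mul_zero]
  have hex' := (hR.exists_mul_pow_eq_zero hab').2
  obtain ⟨i, hi⟩ : ∃ i, Nat.find hex' = i + 2 := by
    refine Nat.exists_eq_add_of_le' ?_
    by_contra! hlt
    have := Nat.find_spec hex'
    interval_cases h : Nat.find hex'
    · exact hj1 (by rw [pow_zero, one_mul] at this; rw [this, mul_zero])
    · exact hj1 (by rwa [pow_one] at this)
  have hi0 : b ^ (i + 2) * a ^ (j + 1) = 0 := hi ▸ Nat.find_spec hex'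
  refine ⟨a ^ (j + 1), b ^ (i + 1), ?_, Nat.find_min hex' (by omega), ?_, ?_⟩
  · rw [pow_succ' b, ← mul_assoc, hab', zero_mul]
  · rw [← mul_assoc, ← pow_add, show i + 1 + (i + 1) = i + (i + 2) by omega, pow_add, mul_assoc,
      hi0, mul_zero]
  · rw [mul_assoc, ← pow_add, show j + 1 + (j + 1) = j + 2 + j by omega, pow_add a (j + 2),
      pow_succ b i, mul_assoc, ← mul_assoc b, hj0, zero_mul, mul_zero]

/-- The combination `i + ja + kb + l(ba)` with coefficients `(i, j, k, l)` in `{0, 1} ⊆ ℕ`. -/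
def normalForm {R : Type u} [Ring R] (a b : R) (c : Fin 2 × Fin 2 × Fin 2 × Fin 2) : R :=
  (c.1 : ℕ) • 1 + (c.2.1 : ℕ) • a + (c.2.2.1 : ℕ) • b + (c.2.2.2 : ℕ) • (b * a)

theorem Fin.eq_of_smul_eq_smul {R : Type u} [Ring R] {w : R} (hw : w ≠ 0) :
    ∀ {i j : Fin 2}, (i : ℕ) • w = (j : ℕ) • w → i = j := by
  intro i j
  fin_cases i <;> fin_cases j <;> simp [hw, hw.symm]

namespace IsExtremalPair

variable {R : Type u} [Ring R] {a b : R}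

theorem normalForm_injective (h : IsExtremalPair a b) :
    Function.Injective (normalForm a b) := by
  obtain ⟨hab, hba, hl, hr⟩ := h
  have hab' (x : R) : a * (b * x) = 0 := by rw [← mul_assoc, hab, zero_mul]
  have hr' : b * (a * a) = 0 := by rw [← mul_assoc, hr]
  rintro ⟨i, j, k, l⟩ ⟨i', j', k', l'⟩ he
  simp only [normalForm] at he
  -- The coefficients of `x = i + ja + kb + l(ba)` are read off from `bxa = i(ba)`,
  -- `bx - xb = j(ba)` and `xa - ax = k(ba)`, in this order.
  have h1 := congrArg (fun x => b * x * a) he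
  simp only [mul_add, add_mul, mul_smul_comm, smul_mul_assoc, mul_one, mul_assoc, hl, hr',
    smul_zero, add_zero] at h1
  obtain rfl := Fin.eq_of_smul_eq_smul hba h1
  have h2 := congrArg (fun x => b * x - x * b) he
  simp only [mul_add, add_mul, mul_smul_comm, smul_mul_assoc, mul_one, one_mul, mul_assoc, hl, hab,
    mul_zero, smul_zero, add_zero, add_sub_add_right_eq_sub,
    add_sub_cancel_left] at h2
  obtain rfl := Fin.eq_of_smul_eq_smul hba h2
  have h3 := congrArg (fun x => x * a - a * x) he
  simp only [mul_add, add_mul, mul_smul_comm, smul_mul_assoc, mul_one, one_mul, mul_assoc, hr', hab,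
    hab', smul_zero, add_zero, add_sub_cancel_left] at h3
  obtain rfl := Fin.eq_of_smul_eq_smul hba h3
  rw [Fin.eq_of_smul_eq_smul hba (add_left_cancel he)]

theorem sixteen_le_natCard [Finite R] (h : IsExtremalPair a b) : 16 ≤ Nat.card R := by
  simpa using Nat.card_le_card_of_injective _ h.normalForm_injective

theorem normalForm_bijective (h : IsExtremalPair a b) (hc : Nat.card R = 16) :
    Function.Bijective (normalForm a b) := by
  have : Finite R := Nat.finite_of_card_ne_zero (by omega)
  exact h.normalForm_injective.bijective_of_nat_card_le (by simp [hc])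

end IsExtremalPair

theorem IsSemicommutativeRing.sixteen_le_mk {R : Type u} [Ring R]
    (hR : IsSemicommutativeRing R) (hn : ¬ IsReflexiveRing R) : 16 ≤ Cardinal.mk R := by
  cases finite_or_infinite R
  · obtain ⟨a, b, h⟩ := exists_isExtremalPair hR hn
    rw [← Nat.cast_card]
    exact_mod_cast h.sixteen_le_natCard
  · exact (Cardinal.ofNat_lt_aleph0.le).trans (Cardinal.aleph0_le_mk R)

/-! ### Rings of order sixteen with an extremal pair -/

/-- `u` and `v` satisfy the defining relations of one of the two rings of order `16`, with `uv ≠ 0`.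
The relations `2u = 2v = 0` follow from the others in both cases. -/
structure IsModel {R : Type u} [Ring R] (u v : R) : Prop where
  vu : v * u = 0
  vv : v * v = 0
  uu : u * u = u * v
  uuu : u * (u * u) = 0
  uv_ne : u * v ≠ 0
  two : (2 : R) = 0 ∨ (2 : R) = u * v

namespace IsExtremalPair

variable {R : Type u} [Ring R] {a b : R}

/-- In a ring of order `16` with extremal pair `(a, b)`, an element commuting with `a` and `b` has
normal form `i + l(ba)`; the condition on `b x a = i(ba)` forces `i = 0`. -/
theorem eq_zero_or_eq_mul (h : IsExtremalPair a b) (hc : Nat.card R = 16) {x : R}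
    (hx : b * x * a ≠ b * a) (hb : b * x = x * b) (ha : x * a = a * x) :
    x = 0 ∨ x = b * a := by
  have hbij := h.normalForm_bijective hc
  obtain ⟨hab, hba, hl, hr⟩ := h
  have hab' (x : R) : a * (b * x) = 0 := by rw [← mul_assoc, hab, zero_mul]
  have hr' : b * (a * a) = 0 := by rw [← mul_assoc, hr]
  obtain ⟨⟨i, j, k, l⟩, rfl⟩ := hbij.2 x
  simp only [normalForm, mul_add, add_mul, mul_smul_comm, smul_mul_assoc, mul_one, one_mul,
    mul_assoc, hl, hab, hr', hab', mul_zero, smul_zero, add_zero] at hx hb ha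
  have hi : i = 0 := by
    fin_cases i
    · rfl
    · exact absurd (by simp) hx
  have hj : j = 0 := by
    refine Fin.eq_of_smul_eq_smul hba (j := 0) ?_
    simpa using hb
  have hk : k = 0 := by
    refine Fin.eq_of_smul_eq_smul hba (j := 0) ?_
    simpa using ha
  subst hi hj hk
  fin_cases l <;> simp [normalForm]

theorem two_eq (h : IsExtremalPair a b) (hc : Nat.card R = 16) :
    (2 : R) = 0 ∨ (2 : R) = b * a := by
  refine h.eq_zero_or_eq_mul hc (fun h2 => h.mul_ne_zero ?_) (by rw [mul_two, two_mul])
    (by rw [mul_two, two_mul])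
  rwa [mul_two, add_mul, add_eq_left] at h2

theorem mul_self_left_eq (h : IsExtremalPair a b) (hc : Nat.card R = 16) :
    a * a = 0 ∨ a * a = b * a := by
  refine h.eq_zero_or_eq_mul hc ?_ ?_ (mul_assoc _ _ _)
  · rw [← mul_assoc b, h.mul_mul_right, zero_mul]
    exact h.mul_ne_zero.symm
  · rw [← mul_assoc, h.mul_mul_right, mul_assoc, h.mul_eq_zero, mul_zero]

theorem mul_self_right_eq (h : IsExtremalPair a b) (hc : Nat.card R = 16) :
    b * b = 0 ∨ b * b = b * a := by
  refine h.eq_zero_or_eq_mul hc ?_ (mul_assoc _ _ _).symm ?_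
  · rw [mul_assoc, mul_assoc, h.mul_mul_left, mul_zero]
    exact h.mul_ne_zero.symm
  · rw [mul_assoc, h.mul_mul_left, ← mul_assoc, h.mul_eq_zero, zero_mul]

theorem mul_add_mul_self (h : IsExtremalPair a b) (hc : Nat.card R = 16) :
    b * a + b * a = 0 := by
  rw [← two_mul]
  obtain h2 | h2 := h.two_eq hc
  · rw [h2, zero_mul]
  · rw [h2, mul_assoc, ← mul_assoc a, h.mul_eq_zero, zero_mul, mul_zero]

/-- The elements with constant term `1` are unipotent. -/
theorem isUnit_normalForm (h : IsExtremalPair a b) {s t : ℕ} (ha : a * a = s • (b * a))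
    (hb : b * b = t • (b * a)) (j k l : Fin 2) : IsUnit (normalForm a b (1, j, k, l)) := by
  obtain ⟨hab, hba, hl, hr⟩ := h
  have hab' (x : R) : a * (b * x) = 0 := by rw [← mul_assoc, hab, zero_mul]
  have hn : IsNilpotent ((j : ℕ) • a + (k : ℕ) • b + (l : ℕ) • (b * a)) := by
    refine ⟨3, ?_⟩
    simp only [pow_succ, pow_zero, one_mul, mul_add, add_mul, mul_smul_comm, smul_mul_assoc,
      mul_assoc, hab, hab', hl, ha, hb, mul_zero, zero_mul, smul_zero, add_zero]
  simpa [normalForm, add_assoc] using hn.isUnit_one_add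

/-- If `a² = b² = ba`, the bilinear form that multiplication induces on the span of `a` and `b` is
nondegenerate: every nonzero combination of `a` and `b` divides `ba` on both sides, so the ring is duo. -/
theorem isDuoRing (h : IsExtremalPair a b) (hc : Nat.card R = 16) (ha : a * a = b * a)
    (hb : b * b = b * a) : IsDuoRing R := by
  have hbij := h.normalForm_bijective hc
  have hunit := h.isUnit_normalForm (s := 1) (t := 1) (by rwa [one_smul]) (by rwa [one_smul])
  obtain ⟨hab, hba, hl, hr⟩ := h
  have hab' (x : R) : a * (b * x) = 0 := by rw [← mul_assoc, hab, zero_mul]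
  have hmul (i j k l j' k' l' : Fin 2) :
      normalForm a b (i, j, k, l) * normalForm a b (0, j', k', l') =
        (i : ℕ) • normalForm a b (0, j', k', l') +
          (j * j' + k * j' + k * k' : ℕ) • (b * a) := by
    simp only [normalForm, mul_add, add_mul, mul_smul_comm, smul_mul_assoc, one_mul,
      mul_assoc, hab, hab', hl, ha, hb, mul_zero, smul_zero, add_zero, Fin.coe_ofNat_eq_mod,
      Nat.zero_mod, zero_smul, zero_add]
    module
  have hmul' (i j k l j' k' l' : Fin 2) :
      normalForm a b (0, j', k', l') * normalForm a b (i, j, k, l) =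
        (i : ℕ) • normalForm a b (0, j', k', l') +
          (j' * j + k' * j + k' * k : ℕ) • (b * a) := by
    simp only [normalForm, mul_add, add_mul, mul_smul_comm, smul_mul_assoc, mul_one,
      mul_assoc, hab, hab', hl, ha, hb, mul_zero, smul_zero, add_zero, Fin.coe_ofNat_eq_mod,
      Nat.zero_mod, zero_smul, zero_add]
    module
  -- Solvability of `x z = ba` and `z x = ba` for `x = ja + kb + l(ba)` with `(j, k) ≠ (0, 0)`.
  have hsol (j k l : Fin 2) : (j = 0 ∧ k = 0) ∨
      ((∃ z, normalForm a b (0, j, k, l) * z = b * a) ∧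
        ∃ z, z * normalForm a b (0, j, k, l) = b * a) := by
    fin_cases j <;> fin_cases k
    · simp
    · exact Or.inr ⟨⟨b, by simp [-nsmul_eq_mul, normalForm, add_mul, mul_assoc, hab, hb]⟩,
        ⟨b, by simp [-nsmul_eq_mul, normalForm, mul_add, hl, hb]⟩⟩
    · exact Or.inr ⟨⟨a, by simp [-nsmul_eq_mul, normalForm, add_mul, mul_assoc, ha, hl]⟩,
        ⟨a, by simp [-nsmul_eq_mul, normalForm, mul_add, hab', ha]⟩⟩
    · exact Or.inr ⟨⟨b, by simp [-nsmul_eq_mul, normalForm, add_mul, mul_assoc, hab, hb]⟩,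
        ⟨a, by simp [-nsmul_eq_mul, normalForm, mul_add, hab, hab', ha]⟩⟩
  constructor
  · intro x y
    obtain ⟨⟨i, j, k, l⟩, rfl⟩ := hbij.2 x
    obtain ⟨⟨i', j', k', l'⟩, rfl⟩ := hbij.2 y
    obtain rfl | rfl : i = 0 ∨ i = 1 := by omega
    · rw [hmul]
      obtain ⟨rfl, rfl⟩ | ⟨⟨z, hz⟩, -⟩ := hsol j k l
      · exact ⟨(i' : ℕ) • 1, by rw [mul_smul_comm, mul_one]; simp⟩
      · rw [← hz]
        exact ⟨(i' : ℕ) • 1 + (j' * j + k' * j + k' * k : ℕ) • z, by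
          rw [mul_add, mul_smul_comm, mul_smul_comm, mul_one]⟩
    · obtain ⟨t, ht⟩ := hunit j k l
      exact ⟨↑t⁻¹ * normalForm a b (i', j', k', l') * t, by
        rw [← ht, mul_assoc, t.mul_inv_cancel_left]⟩
  · intro x y
    obtain ⟨⟨i, j, k, l⟩, rfl⟩ := hbij.2 x
    obtain ⟨⟨i', j', k', l'⟩, rfl⟩ := hbij.2 y
    obtain rfl | rfl : i = 0 ∨ i = 1 := by omega
    · rw [hmul']
      obtain ⟨rfl, rfl⟩ | ⟨-, ⟨z, hz⟩⟩ := hsol j k l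
      · exact ⟨(i' : ℕ) • 1, by rw [smul_mul_assoc, one_mul]; simp⟩
      · rw [← hz]
        exact ⟨(i' : ℕ) • 1 + (j * j' + k * j' + k * k' : ℕ) • z, by
          rw [add_mul, smul_mul_assoc, smul_mul_assoc, one_mul]⟩
    · obtain ⟨t, ht⟩ := hunit j k l
      exact ⟨t * normalForm a b (i', j', k', l') * ↑t⁻¹, by rw [← ht, t.inv_mul_cancel_right]⟩

/-- Apart from the duo case `a² = b² = ba`, the form induced by multiplication on the span of `a`
and `b` has rank one, hence is a product `f(x) g(y)` of independent functionals. Choosing `u`, `v` with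
`f(u) = g(u) = g(v) = 1` and `f(v) = 0` gives the required relations. -/
theorem exists_isModel (h : IsExtremalPair a b) (hc : Nat.card R = 16) (hd : ¬ IsDuoRing R) :
    ∃ u v : R, IsModel u v := by
  have hadd := h.mul_add_mul_self hc
  have htwo := h.two_eq hc
  have hab := h.mul_eq_zero
  have hba := h.mul_ne_zero
  have hl := h.mul_mul_left
  have hab' (x : R) : a * (b * x) = 0 := by rw [← mul_assoc, hab, zero_mul]
  obtain ha | ha := h.mul_self_left_eq hc <;> obtain hb | hb := h.mul_self_right_eq hc
  · refine ⟨a + b, a, ?_, ha, ?_, ?_, ?_, ?_⟩ <;> simp [mul_add, add_mul, *]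
  · refine ⟨b, a, hab, ha, hb, ?_, hba, htwo⟩
    rw [hb, hl]
  · refine ⟨a, a + b, ?_, ?_, ?_, ?_, ?_, ?_⟩ <;> simp [mul_add, add_mul, *]
  · exact absurd (h.isDuoRing hc ha hb) hd

end IsExtremalPair

/-! ### Rings satisfying the defining relations -/

namespace IsModel

variable {R : Type u} [Ring R] {u v : R}

theorem isExtremalPair (h : IsModel u v) : IsExtremalPair v u where
  mul_eq_zero := h.vu
  mul_ne_zero := h.uv_ne
  mul_mul_left := by rw [← h.uu, h.uuu]
  mul_mul_right := by rw [mul_assoc, h.vv, mul_zero]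

theorem two_mul_left (h : IsModel u v) : 2 * u = 0 := by
  obtain h2 | h2 := h.two
  · rw [h2, zero_mul]
  · rw [h2, mul_assoc, h.vu, mul_zero]

theorem two_mul_right (h : IsModel u v) : 2 * v = 0 := by
  obtain h2 | h2 := h.two
  · rw [h2, zero_mul]
  · rw [h2, mul_assoc, h.vv, mul_zero]

/-- Generators satisfying the relations put every element into normal form. -/
theorem normalForm_surjective (h : IsModel u v) (hgen : Subring.closure {u, v} = ⊤) :
    Function.Surjective (normalForm v u) := by
  have hu2 := h.two_mul_left
  have hv2 := h.two_mul_right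
  obtain ⟨-, -, hl, -⟩ := h.isExtremalPair
  obtain ⟨hvu, hvv, huu, huuu, -, htwo⟩ := h
  have hvu' (x : R) : v * (u * x) = 0 := by rw [← mul_assoc, hvu, zero_mul]
  have key (x : R) : ∃ i j k l : ℤ, x = i • 1 + j • v + k • u + l • (u * v) := by
    have hx : x ∈ Subring.closure {u, v} := hgen ▸ Subring.mem_top x
    induction hx using Subring.closure_induction with
    | mem x hx =>
      obtain rfl | rfl := hx
      · exact ⟨0, 0, 1, 0, by simp⟩
      · exact ⟨0, 1, 0, 0, by simp⟩
    | zero => exact ⟨0, 0, 0, 0, by simp⟩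
    | one => exact ⟨1, 0, 0, 0, by simp⟩
    | add x y _ _ hx hy =>
      obtain ⟨i, j, k, l, rfl⟩ := hx
      obtain ⟨i', j', k', l', rfl⟩ := hy
      exact ⟨i + i', j + j', k + k', l + l', by module⟩
    | neg x _ hx =>
      obtain ⟨i, j, k, l, rfl⟩ := hx
      exact ⟨-i, -j, -k, -l, by module⟩
    | mul x y _ _ hx hy =>
      obtain ⟨i, j, k, l, rfl⟩ := hx
      obtain ⟨i', j', k', l', rfl⟩ := hy
      refine ⟨i * i', i * j' + i' * j, i * k' + i' * k, i * l' + i' * l + k * j' + k * k', ?_⟩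
      simp only [mul_add, add_mul, mul_smul_comm, smul_mul_assoc, mul_one, one_mul, mul_assoc, hl,
        hvu, hvv, huu, hvu', mul_zero, smul_zero, add_zero]
      module
  -- Reduction of the integer coefficients modulo `2`; that of `1` carries into that of `uv`.
  have red {y : R} (hy : 2 * y = 0) (i : ℤ) : ∃ e : Fin 2, (e : ℕ) • y = i • y := by
    obtain ⟨q, rfl | rfl⟩ := i.even_or_odd'
    · exact ⟨0, by rw [mul_comm, mul_smul, two_zsmul, ← two_mul, hy]; simp⟩
    · exact ⟨1, by rw [add_smul, mul_comm, mul_smul, two_zsmul, ← two_mul, hy]; simp⟩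
  have huv2 : 2 * (u * v) = 0 := by rw [← mul_assoc, hu2, zero_mul]
  have red1 (i : ℤ) : ∃ (e : Fin 2) (m : ℤ), i • (1 : R) = (e : ℕ) • 1 + m • (u * v) := by
    obtain ⟨m, hm⟩ : ∃ m : ℤ, (2 : R) = m • (u * v) :=
      htwo.elim (fun h2 => ⟨0, by simpa using h2⟩) (fun h2 => ⟨1, by simpa using h2⟩)
    have h2 (q : ℤ) : (2 * q) • (1 : R) = (q * m) • (u * v) := by
      rw [mul_comm, mul_smul, two_zsmul, one_add_one_eq_two, hm, mul_smul]
    obtain ⟨q, rfl | rfl⟩ := i.even_or_odd'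
    · exact ⟨0, q * m, by rw [h2]; simp⟩
    · exact ⟨1, q * m, by rw [add_smul, h2, add_comm]; simp⟩
  intro x
  obtain ⟨i, j, k, l, rfl⟩ := key x
  obtain ⟨i', m, hi⟩ := red1 i
  obtain ⟨j', hj⟩ := red hv2 j
  obtain ⟨k', hk⟩ := red hu2 k
  obtain ⟨l', hl⟩ := red huv2 (m + l)
  refine ⟨(i', j', k', l'), ?_⟩
  rw [hi, ← hj, ← hk, normalForm, hl]
  module

theorem isNonreflexiveSemicommutativeNonduo (h : IsModel u v)
    (hs : Function.Surjective (normalForm v u)) : IsNonreflexiveSemicommutativeNonduo R := by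
  have hunit := h.isExtremalPair.isUnit_normalForm (s := 0) (t := 1)
    (by rw [zero_smul, h.vv]) (by rw [one_smul, h.uu])
  obtain ⟨-, -, hl, -⟩ := h.isExtremalPair
  obtain ⟨hvu, hvv, huu, huuu, huv, htwo⟩ := h
  have hvu' (x : R) : v * (u * x) = 0 := by rw [← mul_assoc, hvu, zero_mul]
  have hsemi : IsSemicommutativeRing R := by
    intro x y hxy r
    obtain ⟨⟨i, j, k, l⟩, rfl⟩ := hs x
    obtain ⟨⟨i', j', k', l'⟩, rfl⟩ := hs y
    obtain rfl | rfl : i = 0 ∨ i = 1 := by omega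
    · obtain rfl | rfl : i' = 0 ∨ i' = 1 := by omega
      · obtain ⟨⟨m, p, q, n⟩, rfl⟩ := hs r
        -- Triple products of nonunits vanish, so only the constant term of `r` contributes.
        calc _ = (m : ℕ) • (normalForm v u (0, j, k, l) * normalForm v u (0, j', k', l')) := by
              simp only [normalForm, mul_add, add_mul, mul_smul_comm, smul_mul_assoc, mul_one,
                mul_assoc, hl, hvu, hvv, huu, hvu', mul_zero, smul_zero, add_zero,
                Fin.coe_ofNat_eq_mod, Nat.zero_mod, zero_smul, zero_add]
              module
          _ = 0 := by rw [hxy, smul_zero]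
      · rw [(hunit j' k' l').mul_left_eq_zero] at hxy
        rw [hxy, zero_mul, zero_mul]
    · rw [(hunit j k l).mul_right_eq_zero] at hxy
      rw [hxy, mul_zero]
  refine ⟨fun hrefl => huv ?_, hsemi, fun hduo => huv ?_⟩
  · simpa using hrefl v u (hsemi v u hvu) 1
  -- Not right duo: `vR = {0, v}` does not contain `uv`.
  · obtain ⟨c, hc⟩ := hduo.1 v u
    obtain ⟨⟨i, j, k, l⟩, rfl⟩ := hs c
    have hc' : u * v = (i : ℕ) • v := by
      rw [hc]
      simp only [normalForm, mul_add, mul_smul_comm, mul_one, hvu, hvv, hvu', smul_zero, add_zero]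
    obtain rfl | rfl : i = 0 ∨ i = 1 := by omega
    · simpa using hc'
    · have : u * v = v := by simpa using hc'
      rw [← hl, this, this]

theorem natCard_eq (h : IsModel u v) (hs : Function.Surjective (normalForm v u)) :
    Nat.card R = 16 := by
  rw [← Nat.card_eq_of_bijective _ ⟨h.isExtremalPair.normalForm_injective, hs⟩]
  simp

/-- A homomorphism matching the distinguished elements matches normal forms; these are distinct in
the codomain and exhaust both rings. -/
theorem bijective_of_map_eq {Q : Type*} [Ring Q] {x y : Q} (h : IsModel u v)
    (hc : Nat.card R = 16) (hs : Function.Surjective (normalForm y x)) (f : Q →+* R)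
    (hx : f x = u) (hy : f y = v) : Function.Bijective f := by
  have hf : f ∘ normalForm y x = normalForm v u := by
    ext c
    simp [normalForm, hx, hy]
  have hbij := h.isExtremalPair.normalForm_bijective hc
  refine ⟨fun p q hpq => ?_, (hf ▸ hbij.2).of_comp⟩
  obtain ⟨c, rfl⟩ := hs p
  obtain ⟨d, rfl⟩ := hs q
  rw [(hf ▸ hbij.1 : Function.Injective (f ∘ normalForm y x)) hpq]

end IsModel

/-! ### Invariance under isomorphism -/

theorem IsNonreflexiveSemicommutativeNonduo.of_ringEquiv {R S : Type*} [Ring R] [Ring S]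
    (e : R ≃+* S) (h : IsNonreflexiveSemicommutativeNonduo R) :
    IsNonreflexiveSemicommutativeNonduo S := by
  obtain ⟨hrefl, hsemi, hduo⟩ := h
  refine ⟨fun hS => hrefl fun a b hab r => e.injective ?_, fun a b hab r => e.symm.injective ?_,
    fun hS => hduo ⟨fun a b => ?_, fun a b => ?_⟩⟩
  · have := hS (e a) (e b) (fun s => by
      simpa using congrArg e (hab (e.symm s))) (e r)
    simpa using this
  · have := hsemi (e.symm a) (e.symm b) (by rw [← map_mul, hab, map_zero]) (e.symm r)
    simpa using this
  · obtain ⟨c, hc⟩ := hS.1 (e a) (e b)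
    exact ⟨e.symm c, e.injective (by simpa using hc)⟩
  · obtain ⟨c, hc⟩ := hS.2 (e a) (e b)
    exact ⟨e.symm c, e.injective (by simpa using hc)⟩

/-! ### Quotients of free algebras on two variables -/

namespace FreeAlgebra

variable {n : ℕ} (s : Set (FreeAlgebra (ZMod n) (Fin 2)))

theorem closure_mk_ι_eq_top :
    Subring.closure {(TwoSidedIdeal.span s).ringCon.mk' (ι (ZMod n) 0),
      (TwoSidedIdeal.span s).ringCon.mk' (ι (ZMod n) 1)} = ⊤ := by
  refine eq_top_iff.2 fun q _ => ?_
  obtain ⟨x, rfl⟩ := RingCon.mk'_surjective _ q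
  induction x using FreeAlgebra.induction with
  | grade0 r =>
    obtain ⟨m, rfl⟩ := ZMod.intCast_surjective r
    simp
  | grade1 i =>
    refine Subring.subset_closure ?_
    fin_cases i <;> simp
  | mul a b ha hb =>
    rw [map_mul]
    exact mul_mem (ha trivial) (hb trivial)
  | add a b ha hb =>
    rw [map_add]
    exact add_mem (ha trivial) (hb trivial)

variable {s}

theorem mk_eq_zero {z : FreeAlgebra (ZMod n) (Fin 2)} (hz : z ∈ s) :
    (TwoSidedIdeal.span s).ringCon.mk' z = 0 :=
  (RingCon.eq _).2 (TwoSidedIdeal.subset_span hz)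

/-- Universal property of `ℤ/n⟨u,v⟩/(s)` among rings in which `n = 0`. The condition on `s` quantifies
over all ring homomorphisms with the prescribed values, so that no `ZMod n`-algebra structure on `T`
has to be fixed. -/
theorem exists_quotient_hom {T : Type*} [Ring T] (hn : (n : T) = 0) (x y : T)
    (hs : ∀ f : FreeAlgebra (ZMod n) (Fin 2) →+* T, f (ι _ 0) = x → f (ι _ 1) = y →
      ∀ z ∈ s, f z = 0) :
    ∃ g : (TwoSidedIdeal.span s).ringCon.Quotient →+* T,
      g ((TwoSidedIdeal.span s).ringCon.mk' (ι _ 0)) = x ∧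
        g ((TwoSidedIdeal.span s).ringCon.mk' (ι _ 1)) = y := by
  -- The characteristic of `T` only needs to divide `n`.
  let _ : Algebra (ZMod n) T := ZMod.algebra' T (ringChar T) ((ringChar.spec T n).1 hn)
  let f : FreeAlgebra (ZMod n) (Fin 2) →+* T := (lift (ZMod n) ![x, y]).toRingHom
  have hx : f (ι _ 0) = x := by simp [f]
  have hy : f (ι _ 1) = y := by simp [f]
  have hker : TwoSidedIdeal.span s ≤ TwoSidedIdeal.ker f :=
    TwoSidedIdeal.span_le.2 fun z hz => (TwoSidedIdeal.mem_ker f).2 (hs f hx hy z hz)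
  exact ⟨RingCon.lift _ f (TwoSidedIdeal.ringCon_le_iff.1 hker), hx, hy⟩

end FreeAlgebra

open FreeAlgebra

/-! ### The two rings of order sixteen -/

theorem exists_ringF2_hom {T : Type*} [Ring T] {x y : T} (h : IsModel x y) (h2 : (2 : T) = 0) :
    ∃ g : RingF2 →+* T, g (idealF2.ringCon.mk' (ι _ 0)) = x ∧
      g (idealF2.ringCon.mk' (ι _ 1)) = y := by
  refine exists_quotient_hom (by exact_mod_cast h2) x y fun f hx hy z hz => ?_
  obtain rfl | rfl | rfl | rfl := hz
  · rw [map_pow, hx, pow_succ', sq, h.uuu]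
  · rw [map_pow, hy, sq, h.vv]
  · rw [map_mul, hx, hy, h.vu]
  · rw [map_sub, map_pow, map_mul, hx, hy, sq, h.uu, sub_self]

theorem exists_ringZ4_hom {T : Type*} [Ring T] {x y : T} (h : IsModel x y) (h2 : (2 : T) = x * y) :
    ∃ g : RingZ4 →+* T, g (idealZ4.ringCon.mk' (ι _ 0)) = x ∧
      g (idealZ4.ringCon.mk' (ι _ 1)) = y := by
  refine exists_quotient_hom ?_ x y fun f hx hy z hz => ?_
  · rw [show ((4 : ℕ) : T) = 2 * 2 by norm_num]
    nth_rw 2 [h2]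
    rw [← mul_assoc, h.two_mul_left, zero_mul]
  obtain rfl | rfl | rfl | rfl | rfl | rfl | rfl := hz
  · rw [map_pow, hx, pow_succ', sq, h.uuu]
  · rw [map_pow, hy, sq, h.vv]
  · rw [map_mul, hx, hy, h.vu]
  · rw [map_sub, map_pow, map_mul, hx, hy, sq, h.uu, sub_self]
  · rw [map_sub, map_ofNat, map_mul, hx, hy, h2, sub_self]
  · rw [map_mul, map_ofNat, hx, h.two_mul_left]
  · rw [map_mul, map_ofNat, hy, h.two_mul_right]

/-- With `u = E₁₂ + E₂₃` and `v = E₂₃`, the relations over `𝔽₂` hold and `uv = E₁₃ ≠ 0`. -/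
theorem isModel_matrix :
    IsModel (!![0, 1, 0; 0, 0, 1; 0, 0, 0] : Matrix (Fin 3) (Fin 3) (ZMod 2))
      !![0, 0, 0; 0, 0, 1; 0, 0, 0] where
  vu := by decide
  vv := by decide
  uu := by decide
  uuu := by decide
  uv_ne := by decide
  two := Or.inl (by decide)

/-- A module over the presented ring of characteristic `4` with `uv ≠ 0`: on `ℤ/4 × ℤ/2`, with
generators `m` and `t`, put `u m = t`, `u t = 2m`, `v m = t` and `v t = 0`, so that `uv` acts
as `2`. -/
theorem exists_isModel_two_eq_mul :
    ∃ x y : AddMonoid.End (ZMod 4 × ZMod 2), IsModel x y ∧ (2 : AddMonoid.End _) = x * y := by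
  let x : AddMonoid.End (ZMod 4 × ZMod 2) :=
    AddMonoidHom.mk' (fun p => (2 * (p.2.val : ZMod 4), (p.1.val : ZMod 2))) (by decide)
  let y : AddMonoid.End (ZMod 4 × ZMod 2) :=
    AddMonoidHom.mk' (fun p => (0, (p.1.val : ZMod 2))) (by decide)
  have h2 : (2 : AddMonoid.End (ZMod 4 × ZMod 2)) = x * y :=
    (one_add_one_eq_two (R := AddMonoid.End (ZMod 4 × ZMod 2))).symm.trans
      (AddMonoidHom.ext (by decide))
  refine ⟨x, y, ⟨AddMonoidHom.ext (by decide), AddMonoidHom.ext (by decide),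
    AddMonoidHom.ext (by decide), AddMonoidHom.ext (by decide), fun h => ?_, Or.inr h2⟩, h2⟩
  exact absurd (DFunLike.congr_fun h (1, 0)) (by decide)

theorem ringF2_two_eq_zero : (2 : RingF2) = 0 := by
  rw [← map_ofNat (algebraMap (ZMod 2) RingF2) 2, show (OfNat.ofNat 2 : ZMod 2) = 0 from rfl,
    map_zero]

theorem isModel_ringF2 :
    IsModel (idealF2.ringCon.mk' (ι _ 0)) (idealF2.ringCon.mk' (ι _ 1)) where
  vu := by
    rw [← map_mul]
    exact mk_eq_zero (by simp)
  vv := by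
    rw [← sq, ← map_pow]
    exact mk_eq_zero (by simp)
  uu := by
    rw [← sq, ← map_pow, ← sub_eq_zero, ← map_mul, ← map_sub]
    exact mk_eq_zero (by simp)
  uuu := by
    rw [← sq, ← pow_succ', ← map_pow]
    exact mk_eq_zero (by simp)
  uv_ne := by
    obtain ⟨g, hx, hy⟩ := exists_ringF2_hom isModel_matrix (by decide)
    intro h
    have := congrArg g h
    rw [map_mul, hx, hy, map_zero] at this
    exact isModel_matrix.uv_ne this
  two := Or.inl ringF2_two_eq_zero

theorem isModel_ringZ4 :
    IsModel (idealZ4.ringCon.mk' (ι _ 0)) (idealZ4.ringCon.mk' (ι _ 1)) ∧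
      (2 : RingZ4) = idealZ4.ringCon.mk' (ι _ 0) * idealZ4.ringCon.mk' (ι _ 1) := by
  have h2 : (2 : RingZ4) = idealZ4.ringCon.mk' (ι _ 0) * idealZ4.ringCon.mk' (ι _ 1) := by
    rw [← map_ofNat idealZ4.ringCon.mk', ← sub_eq_zero, ← map_mul, ← map_sub]
    exact mk_eq_zero (by simp)
  refine ⟨⟨?_, ?_, ?_, ?_, ?_, Or.inr h2⟩, h2⟩
  · rw [← map_mul]
    exact mk_eq_zero (by simp)
  · rw [← sq, ← map_pow]
    exact mk_eq_zero (by simp)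
  · rw [← sq, ← map_pow, ← sub_eq_zero, ← map_mul, ← map_sub]
    exact mk_eq_zero (by simp)
  · rw [← sq, ← pow_succ', ← map_pow]
    exact mk_eq_zero (by simp)
  · obtain ⟨x, y, hxy, hxy2⟩ := exists_isModel_two_eq_mul
    obtain ⟨g, hx, hy⟩ := exists_ringZ4_hom hxy hxy2
    intro h
    have := congrArg g h
    rw [map_mul, hx, hy, map_zero] at this
    exact hxy.uv_ne this

theorem ringF2_normalForm_surjective : Function.Surjective
    (normalForm (idealF2.ringCon.mk' (ι _ 1)) (idealF2.ringCon.mk' (ι _ 0))) :=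
  isModel_ringF2.normalForm_surjective (closure_mk_ι_eq_top _)

theorem ringZ4_normalForm_surjective : Function.Surjective
    (normalForm (idealZ4.ringCon.mk' (ι _ 1)) (idealZ4.ringCon.mk' (ι _ 0))) :=
  isModel_ringZ4.1.normalForm_surjective (closure_mk_ι_eq_top _)

theorem natCard_ringF2 : Nat.card RingF2 = 16 :=
  isModel_ringF2.natCard_eq ringF2_normalForm_surjective

theorem natCard_ringZ4 : Nat.card RingZ4 = 16 :=
  isModel_ringZ4.1.natCard_eq ringZ4_normalForm_surjective

theorem isNonreflexiveSemicommutativeNonduo_ringF2 :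
    IsNonreflexiveSemicommutativeNonduo RingF2 :=
  isModel_ringF2.isNonreflexiveSemicommutativeNonduo ringF2_normalForm_surjective

theorem isNonreflexiveSemicommutativeNonduo_ringZ4 :
    IsNonreflexiveSemicommutativeNonduo RingZ4 :=
  isModel_ringZ4.1.isNonreflexiveSemicommutativeNonduo ringZ4_normalForm_surjective

/-! ### Classification -/

/-- Minimality amounts to having order `16`: the bound `IsSemicommutativeRing.sixteen_le_mk` is
attained in every universe by a lift of `RingF2`. -/
theorem isMinimalRingWith_iff {R : Type u} [Ring R] :
    IsMinimalRingWith IsNonreflexiveSemicommutativeNonduo R ↔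
      IsNonreflexiveSemicommutativeNonduo R ∧ Nat.card R = 16 := by
  have hcard {S : Type u} : Nat.card S = 16 ↔ Cardinal.mk S = 16 := by
    rw [Nat.card, Cardinal.toNat_eq_ofNat]
  refine ⟨fun h => ⟨h.1, hcard.2 (le_antisymm ?_ (h.1.2.1.sixteen_le_mk h.1.1))⟩,
    fun h => ⟨h.1, fun S _ hS => (hcard.1 h.2).trans_le (hS.2.1.sixteen_le_mk hS.1)⟩⟩
  refine (h.2 (ULift.{u} RingF2)
    (isNonreflexiveSemicommutativeNonduo_ringF2.of_ringEquiv ULift.ringEquiv.symm)).trans_eq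
    (hcard.1 ?_)
  rw [Nat.card_congr Equiv.ulift, natCard_ringF2]

theorem nonempty_ringEquiv_of_natCard_eq {R : Type u} [Ring R]
    (h : IsNonreflexiveSemicommutativeNonduo R) (hc : Nat.card R = 16) :
    Nonempty (R ≃+* RingF2) ∨ Nonempty (R ≃+* RingZ4) := by
  have : Finite R := Nat.finite_of_card_ne_zero (by omega)
  obtain ⟨a, b, hab⟩ := exists_isExtremalPair h.2.1 h.1
  obtain ⟨x, y, hxy⟩ := hab.exists_isModel hc h.2.2
  refine hxy.two.imp (fun h2 => ?_) (fun h2 => ?_)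
  · obtain ⟨g, hx, hy⟩ := exists_ringF2_hom hxy h2
    exact ⟨(RingEquiv.ofBijective g (hxy.bijective_of_map_eq hc
      ringF2_normalForm_surjective g hx hy)).symm⟩
  · obtain ⟨g, hx, hy⟩ := exists_ringZ4_hom hxy h2
    exact ⟨(RingEquiv.ofBijective g (hxy.bijective_of_map_eq hc
      ringZ4_normalForm_surjective g hx hy)).symm⟩

/-- The element `2` is zero in the first ring and equals `uv ≠ 0` in the second. -/
theorem isEmpty_ringEquiv : IsEmpty (RingF2 ≃+* RingZ4) := by
  refine ⟨fun e => isModel_ringZ4.1.uv_ne ?_⟩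
  rw [← isModel_ringZ4.2, ← map_ofNat e, ringF2_two_eq_zero, map_zero]

theorem mainTheorem2 :
    (∀ (R : Type u) [Ring R],
      IsMinimalRingWith IsNonreflexiveSemicommutativeNonduo R → Nat.card R = 16) ∧
    (∀ (R : Type u) [Ring R],
      IsMinimalRingWith IsNonreflexiveSemicommutativeNonduo R ↔
        Nonempty (R ≃+* RingF2) ∨ Nonempty (R ≃+* RingZ4)) ∧
    IsMinimalRingWith IsNonreflexiveSemicommutativeNonduo RingF2 ∧
    IsMinimalRingWith IsNonreflexiveSemicommutativeNonduo RingZ4 ∧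
    Nat.card RingF2 = 16 ∧ Nat.card RingZ4 = 16 ∧
    IsEmpty (RingF2 ≃+* RingZ4) := by
  refine ⟨fun R _ h => (isMinimalRingWith_iff.1 h).2, fun R _ => ?_,
    isMinimalRingWith_iff.2 ⟨isNonreflexiveSemicommutativeNonduo_ringF2, natCard_ringF2⟩,
    isMinimalRingWith_iff.2 ⟨isNonreflexiveSemicommutativeNonduo_ringZ4, natCard_ringZ4⟩,
    natCard_ringF2, natCard_ringZ4, isEmpty_ringEquiv⟩
  rw [isMinimalRingWith_iff]
  refine ⟨fun h => nonempty_ringEquiv_of_natCard_eq h.1 h.2, ?_⟩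
  rintro (⟨⟨e⟩⟩ | ⟨⟨e⟩⟩)
  · exact ⟨isNonreflexiveSemicommutativeNonduo_ringF2.of_ringEquiv e.symm,
      (Nat.card_congr e.toEquiv).trans natCard_ringF2⟩
  · exact ⟨isNonreflexiveSemicommutativeNonduo_ringZ4.of_ringEquiv e.symm,
      (Nat.card_congr e.toEquiv).trans natCard_ringZ4⟩
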